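/- **Setting.** A network over time consists of a finite directed graph $G=(V,A)$ (parallel arcs are allowed) with source $s$ and sink $t$, and for every arc $a$ a capacity $u_a$, a transit time $\tau_a$ and a cost $c_a$, all nonnegative integers. $G$ is *series-parallel* if it is two-terminal series-parallel with source terminal $s$ and sink terminal $t$, i.e. it arises from single arcs by series and parallel compositions. Let $\mathcal P$ be the set of simple $s$-$t$ paths; for $p\in\mathcal P$ put $\tau(p)=\sum_{a\in p}\tau_a$ and $u(p)=\min_{a\in p}u_a$. Fix a time horizon $T\in\mathbb N$. A *path decomposition* is a function $y:\mathcal P\to\mathbb R_{\ge 0}$ whose static flow $Y(a)=\sum_{p\ni a}y(p)$ satisfies $Y(a)\le u_a$ for all $a\in A$. The *temporally repeated flow* $f$ of $y$ with horizon $T$ has, for $\theta\in[0,T)$ and $a=(v,w)$, the inflow rate $$f_a(\theta)=\sum\{\,y(p) : p\in\mathcal P,\ a\in p,\ \tau(p|_{s,v})\le\theta,\ \tau(p|_{v,t})<T-\theta\,\},$$ and $f_a(\theta)=0$ for $\theta\notin[0,T)$. Its *value* is $$\mathrm{val}(f)=\sum_{a\in\delta^+(s)}\int_0^T f_a(\xi)\,d\xi-\sum_{a\in\delta^-(s)}\int_0^{T-\tau_a}f_a(\xi)\,d\xi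 ,$$ and its *peak cost* is $$c^{\max}(f)=\max_{\theta\in[0,T)}\ \sum_{a\in A}c_a\int_{\theta-\tau_a}^{\theta}f_a(\xi)\,d\xi .$$ Let $D^{\max}$ be the largest value of a temporally repeated flow with horizon $T$. For a demand $D$, a *minimum-peak-cost* temporally repeated flow is one that minimises $c^{\max}$ among all temporally repeated flows with horizon $T$ and value at least $D$. **Theorem.** Let the network be series-parallel with unit costs ($c_a=1$ for all $a\in A$), let $T\in\mathbb N$, let $D$ be a positive integer with $D\le D^{\max}$, and let $p^*$ be an $s$-$t$ path of minimum transit time. Then $\tau(p^*)<T$, and there is a minimum-peak-cost temporally repeated flow of value exactly $D$ whose path decomposition $y$ takes rational values, is positive only on paths of transit time at most $T$, and satisfies $$y(p^*)=\min\Bigl\{u(p^*),\ \frac{D}{T-\tau(p^*)}\Bigr\}.$$ Moreover this flow uses $p^*$ at full capacity: for every arc $a\in p^*$, its static flow $Y$ satisfies $Y(a)\ge u(p^*)$ if $D\ge u(p^*)\,(T-\tau(p^*))$, and $Y(a)=\frac{D}{T-\tau(p^*)}$ otherwise. -/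

import Mathlib

open MeasureTheory

noncomputable section

/-- A network over time: a directed graph (given by the tail `src a` and the head `dst a` of each
arc `a`; parallel arcs are allowed) with source, sink, capacities, transit times and arc costs. -/
structure Network (V A : Type*) where
  src : A → V
  dst : A → V
  source : V
  sink : V
  cap : A → ℕ
  transit : A → ℕ
  cost : A → ℕ

namespace Network

variable {V A : Type*}

/-! ### Two-terminal series-parallel graphs -/

/-- The nodes that are an end of some arc of `E`. -/
def nodes (N : Network V A) (E : Set A) : Set V :=
  {v | ∃ a ∈ E, N.src a = v ∨ N.dst a = v}

/-- `N.SP E u v`: the subgraph formed by the arcs `E` and their ends is two-terminal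
series-parallel with source terminal `u` and sink terminal `v`. -/
inductive SP (N : Network V A) : Set A → V → V → Prop
  | arc (a : A) (h : N.src a ≠ N.dst a) : SP N {a} (N.src a) (N.dst a)
  | series {E₁ E₂ : Set A} {u m v : V} (h₁ : SP N E₁ u m) (h₂ : SP N E₂ m v)
      (h : N.nodes E₁ ∩ N.nodes E₂ = {m}) : SP N (E₁ ∪ E₂) u v
  | parallel {E₁ E₂ : Set A} {u v : V} (h₁ : SP N E₁ u v) (h₂ : SP N E₂ u v)
      (hE : Disjoint E₁ E₂) (h : N.nodes E₁ ∩ N.nodes E₂ = {u, v}) : SP N (E₁ ∪ E₂) u v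

/-- The whole graph is two-terminal series-parallel, its terminals being the source and the sink. -/
def IsSeriesParallel (N : Network V A) : Prop :=
  N.SP Set.univ N.source N.sink ∧ N.nodes Set.univ = Set.univ

/-! ### Simple source-sink paths -/

/-- The list of arcs `l` is a walk from `u` to `v`. -/
def IsWalk (N : Network V A) : V → List A → V → Prop
  | u, [], v => u = v
  | u, a :: l, v => N.src a = u ∧ IsWalk N (N.dst a) l v

/-- Simple paths from the source to the sink, recorded as lists of arcs; the visited nodes
are pairwise distinct. -/
structure STPath (N : Network V A) where
  arcs : List A
  isWalk : N.IsWalk N.source arcs N.sink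
  nodup : (N.source :: arcs.map N.dst).Nodup

theorem STPath.arcs_nodup {N : Network V A} (p : N.STPath) : p.arcs.Nodup :=
  List.Nodup.of_map _ (List.nodup_cons.1 p.nodup).2

instance instFiniteSTPath (N : Network V A) [Finite A] : Finite N.STPath := by
  classical
  have := Fintype.ofFinite A
  refine Finite.of_injective
    (fun p : N.STPath => (⟨p.arcs, p.arcs_nodup⟩ : {l : List A // l.Nodup})) ?_
  rintro ⟨l, _, _⟩ ⟨l', _, _⟩ h
  simpa using h

instance instFintypeSTPath (N : Network V A) [Finite A] : Fintype N.STPath :=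
  Fintype.ofFinite _

/-- The transit time (length) of a path. -/
def STPath.length {N : Network V A} (p : N.STPath) : ℕ := (p.arcs.map N.transit).sum

/-- The bottleneck capacity of a path: the minimum of the capacities of its arcs. -/
def STPath.bottleneck {N : Network V A} (p : N.STPath) : ℕ := sInf (N.cap '' {a | a ∈ p.arcs})

/-- A shortest source-sink path with respect to transit time. -/
def STPath.IsShortest {N : Network V A} (p : N.STPath) : Prop :=
  ∀ q : N.STPath, p.length ≤ q.length

open Classical in
/-- For an arc `a = (v, w)` of `p`: the transit time of the part of `p` from the source to `v`. -/
def STPath.lengthTo {N : Network V A} (p : N.STPath) (a : A) : ℕ :=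
  ((p.arcs.takeWhile (fun b => decide (b ≠ a))).map N.transit).sum

open Classical in
/-- For an arc `a = (v, w)` of `p`: the transit time of the part of `p` from `v` to the sink
(the arc `a` included). -/
def STPath.lengthFrom {N : Network V A} (p : N.STPath) (a : A) : ℕ :=
  ((p.arcs.dropWhile (fun b => decide (b ≠ a))).map N.transit).sum

/-! ### Path decompositions, temporally repeated flows, value and peak cost -/

open Classical in
/-- The static flow with path decomposition `y`. -/
def staticFlow (N : Network V A) [Fintype A] (y : N.STPath → ℝ) (a : A) : ℝ :=
  ∑ p : N.STPath, if a ∈ p.arcs then y p else 0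

/-- `y` is the path decomposition of a feasible static flow. -/
def IsFeasible (N : Network V A) [Fintype A] (y : N.STPath → ℝ) : Prop :=
  (∀ p, 0 ≤ y p) ∧ ∀ a, N.staticFlow y a ≤ N.cap a

/-- All flow-carrying paths have length at most `T`. -/
def IsBounded (N : Network V A) (T : ℕ) (y : N.STPath → ℝ) : Prop :=
  ∀ p : N.STPath, 0 < y p → p.length ≤ T

open Classical in
/-- The temporally repeated flow with time horizon `T` and path decomposition `y`: the inflow rate
into arc `a` at time `θ` is the total rate of those paths through `a` that can transport flow
over `a` at time `θ` without violating the time horizon. -/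
def trFlow (N : Network V A) [Fintype A] (T : ℕ) (y : N.STPath → ℝ) (a : A) (θ : ℝ) : ℝ :=
  if 0 ≤ θ ∧ θ < T then
    ∑ p : N.STPath,
      if a ∈ p.arcs ∧ (p.lengthTo a : ℝ) ≤ θ ∧ (p.lengthFrom a : ℝ) < T - θ then y p else 0
  else 0

open Classical in
/-- The value of a flow over time `f` with time horizon `T`. -/
def value (N : Network V A) [Fintype A] (T : ℕ) (f : A → ℝ → ℝ) : ℝ :=
  (∑ a : A, if N.src a = N.source then ∫ ξ in (0 : ℝ)..T, f a ξ else 0) -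
    ∑ a : A, if N.dst a = N.source then ∫ ξ in (0 : ℝ)..(T - N.transit a), f a ξ else 0

/-- The cost of a flow over time `f` at time `θ`. -/
def costAt (N : Network V A) [Fintype A] (f : A → ℝ → ℝ) (θ : ℝ) : ℝ :=
  ∑ a : A, (N.cost a : ℝ) * ∫ ξ in (θ - N.transit a)..θ, f a ξ

/-- The peak cost of a flow over time `f` with time horizon `T`: its maximum cost at a time
in `[0, T)`. -/
def peakCost (N : Network V A) [Fintype A] (T : ℕ) (f : A → ℝ → ℝ) : ℝ :=
  sSup (N.costAt f '' Set.Ico (0 : ℝ) T)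

theorem abs_trFlow_le (N : Network V A) [Fintype A] (T : ℕ) (y : N.STPath → ℝ) (a : A) (θ : ℝ) :
    |N.trFlow T y a θ| ≤ ∑ p, |y p| := by
  have h0 : (0 : ℝ) ≤ ∑ p, |y p| := Finset.sum_nonneg fun p _ => abs_nonneg _
  unfold trFlow
  split_ifs
  · refine (Finset.abs_sum_le_sum_abs _ _).trans (Finset.sum_le_sum fun p _ => ?_)
    split_ifs
    · exact le_rfl
    · simp
  · simpa using h0

/-- The supremum defining the peak cost of a temporally repeated flow is over a bounded set. -/
theorem bddAbove_costAt_trFlow (N : Network V A) [Fintype A] (T : ℕ) (y : N.STPath → ℝ) :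
    BddAbove (N.costAt (N.trFlow T y) '' Set.Ico (0 : ℝ) T) := by
  refine ⟨∑ a : A, (N.cost a : ℝ) * ((∑ p, |y p|) * N.transit a), ?_⟩
  rintro _ ⟨θ, _, rfl⟩
  refine Finset.sum_le_sum fun a _ => mul_le_mul_of_nonneg_left ?_ (Nat.cast_nonneg _)
  have h := intervalIntegral.norm_integral_le_of_norm_le_const
    (a := θ - N.transit a) (b := θ) (f := N.trFlow T y a) (C := ∑ p, |y p|)
    (fun ξ _ => N.abs_trFlow_le T y a ξ)
  have h2 : |θ - (θ - N.transit a)| = (N.transit a : ℝ) := by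
    rw [sub_sub_cancel]; exact abs_of_nonneg (Nat.cast_nonneg _)
  rw [h2] at h
  exact (le_abs_self _).trans h

/-- The temporally repeated flow of `y` is feasible, has value at least `D`, and has minimum peak
cost among all such temporally repeated flows. -/
def IsMinPeakCost (N : Network V A) [Fintype A] (T D : ℕ)
    (y : N.STPath → ℝ) : Prop :=
  N.IsFeasible y ∧ (D : ℝ) ≤ N.value T (N.trFlow T y) ∧
    ∀ z : N.STPath → ℝ, N.IsFeasible z → (D : ℝ) ≤ N.value T (N.trFlow T z) →
      N.peakCost T (N.trFlow T y) ≤ N.peakCost T (N.trFlow T z)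

end Network

end

/-!
With unit costs, the flow that departs along a path of length `l` is on that path, at time `θ`, in
an amount which is largest at `θ = T / 2`, whatever `l ≤ T` is, and then equals `min l (T - l)` per
unit of rate (`peakCost_trFlow`). Since the value is `max 0 (T - l)` per unit of rate
(`value_trFlow`), minimising the peak cost is a linear program in the path decomposition.

Let `x` be the length of the longest path in use. The cost of a path of length `l` exceeds
`ρ` times its value by at least `- K * max 0 (t - l)`, with equality for `l ≤ x`, where `ρ` is the
ratio of cost and value of a path of length `x` and `t ≤ x` (`exists_multipliers`). Hence a path
decomposition of value `D` has minimum peak cost as soon as it maximises the total of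
`max 0 (t - l)`.

In a series-parallel network with integral capacities a greedy flow, which sends single units along
walks of increasing length, maximises this total for all thresholds `t` simultaneously
(`IsGreedy.sum_le`). This greedy flow and, for each `t`, a dual solution that certifies its
optimality are built along the series-parallel structure (`SP.exists_isGreedy`). A parallel
composition merges the two lists of walks. A series composition concatenates the `i`-th walks of
the two lists; since both lists are sorted, `t` splits into thresholds `t₁ + t₂` for the two parts
such that concatenated walks are both below or both above their thresholds
(`exists_split_threshold`), and so the dual solutions of the parts fit together. The
construction may start with any shortest path `q` and then uses `q` until one of its arcs is
saturated.

Cutting the greedy list off at the value `D`, with a fraction of the last path, gives a rational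
path decomposition. Either the cut lies behind the initial copies of `q`, so that `q` carries its
bottleneck capacity, or `q` is the only path in use.
-/

noncomputable section

namespace Network

variable {V A : Type*}

/-! ### Walks in series-parallel graphs -/

/-- `l` is a walk from `u` to `v` all of whose arcs belong to `E`. -/
def WalkIn (N : Network V A) (E : Set A) (u : V) (l : List A) (v : V) : Prop :=
  (∀ a ∈ l, a ∈ E) ∧ N.IsWalk u l v

/-- The transit time of a list of arcs. -/
def len (N : Network V A) (l : List A) : ℕ := (l.map N.transit).sum

theorem len_append (N : Network V A) (l l' : List A) : N.len (l ++ l') = N.len l + N.len l' := by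
  simp [len]

theorem IsWalk.append {N : Network V A} {l l' : List A} {u m v : V} (h : N.IsWalk u l m)
    (h' : N.IsWalk m l' v) : N.IsWalk u (l ++ l') v := by
  induction l generalizing u with
  | nil => obtain rfl : u = m := h; exact h'
  | cons a l ih => exact ⟨h.1, ih h.2⟩

theorem WalkIn.mono {N : Network V A} {E F : Set A} {l : List A} {u v : V}
    (h : N.WalkIn E u l v) (hEF : E ⊆ F) : N.WalkIn F u l v :=
  ⟨fun a ha => hEF (h.1 a ha), h.2⟩

theorem WalkIn.append {N : Network V A} {E₁ E₂ : Set A} {l l' : List A} {u m v : V}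
    (h : N.WalkIn E₁ u l m) (h' : N.WalkIn E₂ m l' v) : N.WalkIn (E₁ ∪ E₂) u (l ++ l') v :=
  ⟨fun a ha => (List.mem_append.1 ha).imp (h.1 a) (h'.1 a), h.2.append h'.2⟩

theorem src_mem_nodes {N : Network V A} {E : Set A} {a : A} (h : a ∈ E) : N.src a ∈ N.nodes E :=
  ⟨a, h, Or.inl rfl⟩

theorem dst_mem_nodes {N : Network V A} {E : Set A} {a : A} (h : a ∈ E) : N.dst a ∈ N.nodes E :=
  ⟨a, h, Or.inr rfl⟩

theorem nodes_union (N : Network V A) (E F : Set A) :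
    N.nodes (E ∪ F) = N.nodes E ∪ N.nodes F := by
  ext v
  simp only [nodes, Set.mem_union, Set.mem_ofPred_eq, or_and_right, exists_or]

/-- In a series-parallel graph the terminals are distinct nodes, no arc enters the source terminal
and no arc leaves the sink terminal. -/
theorem SP.terminals {N : Network V A} {E : Set A} {u v : V} (h : N.SP E u v) :
    u ≠ v ∧ u ∈ N.nodes E ∧ v ∈ N.nodes E ∧ (∀ a ∈ E, N.dst a ≠ u) ∧ ∀ a ∈ E, N.src a ≠ v := by
  induction h with
  | arc a h =>
    refine ⟨h, src_mem_nodes rfl, dst_mem_nodes rfl, ?_, ?_⟩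
    · rintro b rfl; exact h.symm
    · rintro b rfl; exact h
  | @series E₁ E₂ u m v _ _ h ih₁ ih₂ =>
    obtain ⟨hum, hu, -, hdu, -⟩ := ih₁
    obtain ⟨hmv, -, hv, -, hsv⟩ := ih₂
    have key : ∀ x, x ∈ N.nodes E₁ → x ∈ N.nodes E₂ → x = m := fun x h₁ h₂ => by
      have : x ∈ N.nodes E₁ ∩ N.nodes E₂ := ⟨h₁, h₂⟩
      rwa [h] at this
    rw [nodes_union]
    refine ⟨fun huv => hum (key u hu (huv ▸ hv)), Or.inl hu, Or.inr hv, ?_, ?_⟩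
    · rintro a (ha | ha)
      · exact hdu a ha
      · exact fun hau => hum (key u hu (hau ▸ dst_mem_nodes ha))
    · rintro a (ha | ha)
      · exact fun hav => hmv (key v (hav ▸ src_mem_nodes ha) hv).symm
      · exact hsv a ha
  | parallel _ _ _ _ ih₁ ih₂ =>
    rw [nodes_union]
    refine ⟨ih₁.1, Or.inl ih₁.2.1, Or.inl ih₁.2.2.1, ?_, ?_⟩
    · rintro a (ha | ha)
      exacts [ih₁.2.2.2.1 a ha, ih₂.2.2.2.1 a ha]
    · rintro a (ha | ha)
      exacts [ih₁.2.2.2.2 a ha, ih₂.2.2.2.2 a ha]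

theorem WalkIn.eq_of_singleton {N : Network V A} {a : A} {l : List A}
    (hl : N.WalkIn {a} (N.src a) l (N.dst a)) (h : N.src a ≠ N.dst a) : l = [a] := by
  obtain ⟨hmem, hw⟩ := hl
  match l, hmem, hw with
  | [], _, hw => exact absurd hw h
  | [b], hmem, _ =>
    obtain rfl : b = a := hmem b (by simp)
    rfl
  | b :: c :: l, hmem, hw =>
    obtain rfl : b = a := hmem b (by simp)
    obtain rfl : c = b := hmem c (by simp)
    exact absurd hw.2.1 h

/-- A walk in a series composition that starts in its second part stays there. -/
theorem WalkIn.right_of_series {N : Network V A} {E₁ E₂ : Set A} {m v x : V} {l : List A}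
    (h : N.nodes E₁ ∩ N.nodes E₂ ⊆ {m}) (hm : ∀ a ∈ E₁, N.src a ≠ m)
    (hx : x ∈ N.nodes E₂) (hl : N.WalkIn (E₁ ∪ E₂) x l v) : N.WalkIn E₂ x l v := by
  induction l generalizing x with
  | nil => exact ⟨by simp, hl.2⟩
  | cons a l ih =>
    obtain ⟨hmem, rfl, hw⟩ := hl
    have ha : a ∈ E₂ := (hmem a (by simp)).resolve_left fun ha =>
      hm a ha (h ⟨src_mem_nodes ha, hx⟩)
    have := ih (dst_mem_nodes ha) ⟨fun b hb => hmem b (by simp [hb]), hw⟩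
    exact ⟨by simpa [ha] using this.1, rfl, hw⟩

/-- A walk in a series composition from its first part to the sink terminal passes through the
middle node. -/
theorem WalkIn.split_of_series {N : Network V A} {E₁ E₂ : Set A} {m v x : V} {l : List A}
    (h : N.nodes E₁ ∩ N.nodes E₂ = {m}) (hm : ∀ a ∈ E₁, N.src a ≠ m) (hv : v ∈ N.nodes E₂)
    (hmv : m ≠ v) (hx : x ∈ N.nodes E₁) (hl : N.WalkIn (E₁ ∪ E₂) x l v) :
    ∃ l₁ l₂, l = l₁ ++ l₂ ∧ N.WalkIn E₁ x l₁ m ∧ N.WalkIn E₂ m l₂ v := by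
  induction l generalizing x with
  | nil =>
    obtain rfl : x = v := hl.2
    exact absurd (h.subset ⟨hx, hv⟩).symm hmv
  | cons a l ih =>
    by_cases hxm : x = m
    · subst hxm
      have hx₂ : x ∈ N.nodes E₂ := (h.superset rfl).2
      exact ⟨[], a :: l, rfl, ⟨by simp, rfl⟩, hl.right_of_series h.subset hm hx₂⟩
    · obtain ⟨hmem, rfl, hw⟩ := hl
      have ha : a ∈ E₁ := (hmem a (by simp)).resolve_right fun ha =>
        hxm (h.subset ⟨hx, src_mem_nodes ha⟩)
      obtain ⟨l₁, l₂, rfl, h₁, h₂⟩ := ih (dst_mem_nodes ha) ⟨fun b hb => hmem b (by simp [hb]), hw⟩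
      exact ⟨a :: l₁, l₂, rfl, ⟨by simpa [ha] using h₁.1, rfl, h₁.2⟩, h₂⟩

/-- A walk to the sink terminal of a parallel composition that starts inside the first part stays
there. -/
theorem WalkIn.left_of_parallel {N : Network V A} {E₁ E₂ : Set A} {u v x : V} {l : List A}
    (h : N.nodes E₁ ∩ N.nodes E₂ ⊆ {u, v}) (hu : ∀ a ∈ E₁ ∪ E₂, N.dst a ≠ u)
    (hv : ∀ a ∈ E₁ ∪ E₂, N.src a ≠ v) (hx : x ∈ N.nodes E₁) (hxu : x ≠ u)
    (hl : N.WalkIn (E₁ ∪ E₂) x l v) : N.WalkIn E₁ x l v := by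
  induction l generalizing x with
  | nil => exact ⟨by simp, hl.2⟩
  | cons a l ih =>
    obtain ⟨hmem, rfl, hw⟩ := hl
    have ha' := hmem a (by simp)
    have ha : a ∈ E₁ := ha'.resolve_right fun ha =>
      (h ⟨hx, src_mem_nodes ha⟩).elim hxu (hv a ha')
    have := ih (dst_mem_nodes ha) (hu a ha') ⟨fun b hb => hmem b (by simp [hb]), hw⟩
    exact ⟨by simpa [ha] using this.1, rfl, hw⟩

theorem WalkIn.or_of_parallel {N : Network V A} {E₁ E₂ : Set A} {u v : V} {l : List A}
    (h : N.nodes E₁ ∩ N.nodes E₂ ⊆ {u, v}) (huv : u ≠ v) (hu : ∀ a ∈ E₁ ∪ E₂, N.dst a ≠ u)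
    (hv : ∀ a ∈ E₁ ∪ E₂, N.src a ≠ v) (hl : N.WalkIn (E₁ ∪ E₂) u l v) :
    N.WalkIn E₁ u l v ∨ N.WalkIn E₂ u l v := by
  cases l with
  | nil => exact absurd hl.2 huv
  | cons a l =>
    obtain ⟨hmem, rfl, hw⟩ := hl
    have hw' : N.WalkIn (E₁ ∪ E₂) (N.dst a) l v := ⟨fun b hb => hmem b (by simp [hb]), hw⟩
    have ha' := hmem a (by simp)
    rcases id ha' with ha | ha
    · have := hw'.left_of_parallel h hu hv (dst_mem_nodes ha) (hu a ha')
      exact Or.inl ⟨by simpa [ha] using this.1, rfl, hw⟩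
    · rw [Set.inter_comm] at h
      rw [Set.union_comm] at hu hv hw'
      have := hw'.left_of_parallel h hu hv (dst_mem_nodes ha) (hu a ha'.symm)
      exact Or.inr ⟨by simpa [ha] using this.1, rfl, hw⟩

theorem SP.split_series {N : Network V A} {E₁ E₂ : Set A} {u m v : V} {l : List A}
    (h₁ : N.SP E₁ u m) (h₂ : N.SP E₂ m v) (h : N.nodes E₁ ∩ N.nodes E₂ = {m})
    (hl : N.WalkIn (E₁ ∪ E₂) u l v) :
    ∃ l₁ l₂, l = l₁ ++ l₂ ∧ N.WalkIn E₁ u l₁ m ∧ N.WalkIn E₂ m l₂ v :=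
  hl.split_of_series h h₁.terminals.2.2.2.2 h₂.terminals.2.2.1 h₂.terminals.1 h₁.terminals.2.1

theorem SP.split_parallel {N : Network V A} {E₁ E₂ : Set A} {u v : V} {l : List A}
    (h₁ : N.SP E₁ u v) (h₂ : N.SP E₂ u v) (hE : Disjoint E₁ E₂)
    (h : N.nodes E₁ ∩ N.nodes E₂ = {u, v})
    (hl : N.WalkIn (E₁ ∪ E₂) u l v) : N.WalkIn E₁ u l v ∨ N.WalkIn E₂ u l v :=
  have ht := (SP.parallel h₁ h₂ hE h).terminals
  hl.or_of_parallel h.subset ht.1 ht.2.2.2.1 ht.2.2.2.2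

theorem SP.disjoint_series {N : Network V A} {E₁ E₂ : Set A} {u m : V}
    (h₁ : N.SP E₁ u m) (h : N.nodes E₁ ∩ N.nodes E₂ = {m}) : Disjoint E₁ E₂ :=
  Set.disjoint_left.2 fun a ha ha' =>
    h₁.terminals.2.2.2.2 a ha (h.subset ⟨src_mem_nodes ha, src_mem_nodes ha'⟩)

/-- Every walk between the terminals of a series-parallel graph is simple. -/
theorem SP.nodup_of_walkIn {N : Network V A} {E : Set A} {u v : V} (h : N.SP E u v) {l : List A}
    (hl : N.WalkIn E u l v) : (u :: l.map N.dst).Nodup := by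
  induction h generalizing l with
  | arc a h =>
    obtain rfl := hl.eq_of_singleton h
    simpa using h
  | @series E₁ E₂ u m v h₁ h₂ h ih₁ ih₂ =>
    obtain ⟨l₁, l₂, rfl, hl₁, hl₂⟩ := h₁.split_series h₂ h hl
    rw [List.map_append, ← List.cons_append]
    refine (ih₁ hl₁).append (List.nodup_cons.1 (ih₂ hl₂)).2 ?_
    intro x hx₁ hx₂
    have hxE₁ : x ∈ N.nodes E₁ := by
      rcases List.mem_cons.1 hx₁ with rfl | hx₁
      · exact h₁.terminals.2.1
      · obtain ⟨a, ha, rfl⟩ := List.mem_map.1 hx₁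
        exact dst_mem_nodes (hl₁.1 a ha)
    obtain ⟨a, ha, rfl⟩ := List.mem_map.1 hx₂
    exact h₂.terminals.2.2.2.1 a (hl₂.1 a ha) (h.subset ⟨hxE₁, dst_mem_nodes (hl₂.1 a ha)⟩)
  | parallel h₁ h₂ hE h ih₁ ih₂ =>
    exact (h₁.split_parallel h₂ hE h hl).elim ih₁ ih₂

theorem SP.exists_walkIn {N : Network V A} {E : Set A} {u v : V} (h : N.SP E u v) :
    ∃ l, N.WalkIn E u l v := by
  induction h with
  | arc a h => exact ⟨[a], by simp, rfl, rfl⟩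
  | series _ _ _ ih₁ ih₂ =>
    obtain ⟨l₁, h₁⟩ := ih₁
    obtain ⟨l₂, h₂⟩ := ih₂
    exact ⟨l₁ ++ l₂, h₁.append h₂⟩
  | parallel _ _ _ _ ih₁ _ =>
    obtain ⟨l₁, h₁⟩ := ih₁
    exact ⟨l₁, h₁.mono Set.subset_union_left⟩

/-- `q` is a shortest walk from `u` to `v` in `E`. -/
def IsShortestIn (N : Network V A) (E : Set A) (u : V) (q : List A) (v : V) : Prop :=
  N.WalkIn E u q v ∧ ∀ l, N.WalkIn E u l v → N.len q ≤ N.len l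

theorem SP.exists_isShortestIn {N : Network V A} {E : Set A} {u v : V} (h : N.SP E u v) :
    ∃ q, N.IsShortestIn E u q v := by
  obtain ⟨q, hq, hmin⟩ := exists_minimalFor_of_wellFoundedLT (fun l => N.WalkIn E u l v) N.len
    h.exists_walkIn
  exact ⟨q, hq, fun l hl => (le_total _ _).elim id fun h => hmin hl h⟩

/-! ### Counting the members of a list of walks that use an arc -/

open Classical in
/-- The number of members of `L` that contain the arc `a`: the static flow on `a` when every
member of `L` carries one unit of flow. -/
def arcCount (L : List (List A)) (a : A) : ℕ := L.countP fun l => a ∈ l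

open Classical in
theorem arcCount_cons (l : List A) (L : List (List A)) (a : A) :
    arcCount (l :: L) a = arcCount L a + if a ∈ l then 1 else 0 := by
  simp only [arcCount, List.countP_cons, decide_eq_true_eq]

@[simp]
theorem arcCount_nil (a : A) : arcCount [] a = 0 := rfl

theorem arcCount_replicate (k : ℕ) {l : List A} {a : A} (h : a ∈ l) :
    arcCount (List.replicate k l) a = k := by
  induction k with
  | zero => rfl
  | succ k ih => rw [List.replicate_succ, arcCount_cons, ih, if_pos h]

theorem arcCount_append (L L' : List (List A)) (a : A) :
    arcCount (L ++ L') a = arcCount L a + arcCount L' a :=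
  List.countP_append

theorem arcCount_eq_zero {L : List (List A)} {a : A} (h : ∀ l ∈ L, a ∉ l) : arcCount L a = 0 :=
  List.countP_eq_zero.2 fun l hl => by simpa using h l hl

theorem _root_.List.Perm.arcCount_eq {L L' : List (List A)} (h : L.Perm L') (a : A) :
    arcCount L a = arcCount L' a :=
  h.countP_eq _

open Classical in
theorem arcCount_zipWith_left {a : A} {L₁ L₂ : List (List A)} (h : ∀ l ∈ L₂, a ∉ l) :
    arcCount (List.zipWith (· ++ ·) L₁ L₂) a = arcCount (L₁.take L₂.length) a := by
  induction L₁ generalizing L₂ with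
  | nil => simp
  | cons l₁ L₁ ih =>
    cases L₂ with
    | nil => simp
    | cons l₂ L₂ =>
      have h₂ : a ∉ l₂ := h l₂ (by simp)
      have := ih (L₂ := L₂) fun l hl => h l (by simp [hl])
      rw [List.zipWith_cons_cons, List.length_cons, List.take_succ_cons, arcCount_cons, arcCount_cons,
        this]
      exact congrArg _ (if_congr (by simp [h₂]) rfl rfl)

open Classical in
theorem arcCount_zipWith_right {a : A} {L₁ L₂ : List (List A)} (h : ∀ l ∈ L₁, a ∉ l) :
    arcCount (List.zipWith (· ++ ·) L₁ L₂) a = arcCount (L₂.take L₁.length) a := by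
  induction L₁ generalizing L₂ with
  | nil => simp
  | cons l₁ L₁ ih =>
    cases L₂ with
    | nil => simp
    | cons l₂ L₂ =>
      have h₁ : a ∉ l₁ := h l₁ (by simp)
      have := ih (L₂ := L₂) fun l hl => h l (by simp [hl])
      rw [List.zipWith_cons_cons, List.length_cons, List.take_succ_cons, arcCount_cons, arcCount_cons,
        this]
      exact congrArg _ (if_congr (by simp [h₁]) rfl rfl)

theorem arcCount_take_le (L : List (List A)) (n : ℕ) (a : A) :
    arcCount (L.take n) a ≤ arcCount L a :=
  (List.take_sublist n L).countP_le

theorem arcCount_take {L : List (List A)} {n : ℕ} {a : A} (h : ∀ l ∈ L.drop n, a ∉ l) :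
    arcCount (L.take n) a = arcCount L a := by
  conv_rhs => rw [← List.take_append_drop n L, arcCount_append, arcCount_eq_zero h, add_zero]

theorem exists_of_mem_zipWith {α β γ : Type*} {f : α → β → γ} {L₁ : List α} {L₂ : List β} {c : γ}
    (h : c ∈ List.zipWith f L₁ L₂) : ∃ x ∈ List.zip L₁ L₂, f x.1 x.2 = c := by
  rw [← List.map_uncurry_zip_eq_zipWith] at h
  obtain ⟨x, hx, rfl⟩ := List.mem_map.1 h
  exact ⟨x, hx, rfl⟩

theorem pairwise_zipWith {α β γ : Type*} {R : α → α → Prop} {S : β → β → Prop} {Q : γ → γ → Prop}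
    {f : α → β → γ} (hQ : ∀ a a' b b', R a a' → S b b' → Q (f a b) (f a' b')) {L₁ : List α}
    {L₂ : List β} (h₁ : L₁.Pairwise R) (h₂ : L₂.Pairwise S) :
    (List.zipWith f L₁ L₂).Pairwise Q := by
  induction h₁ generalizing L₂ with
  | nil => simp
  | @cons a L₁ ha h₁ ih =>
    cases h₂ with
    | nil => simp
    | @cons b L₂ hb h₂ =>
      refine List.pairwise_cons.2 ⟨fun c hc => ?_, ih h₂⟩
      obtain ⟨x, hx, rfl⟩ := exists_of_mem_zipWith hc
      have := List.of_mem_zip hx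
      exact hQ _ _ _ _ (ha _ this.1) (hb _ this.2)

/-- Two sorted lists are zipped. Any threshold `t` for the sums of partners splits as `t₁ + t₂`
so that partners lie on the same side of `t₁` and `t₂`, and elements that
remain without a partner lie above the threshold of their list. -/
theorem exists_split_threshold {α : Type*} {f : α → ℕ} {L₁ L₂ : List α}
    (h₁ : L₁.Pairwise fun x y => f x ≤ f y) (h₂ : L₂.Pairwise fun x y => f x ≤ f y)
    {b₁ b₂ t : ℝ} (hb₁ : ∀ x ∈ L₁, b₁ ≤ f x) (hb₂ : ∀ x ∈ L₂, b₂ ≤ f x) (ht : b₁ + b₂ ≤ t) :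
    ∃ t₁ t₂ : ℝ, t₁ + t₂ = t ∧ b₁ ≤ t₁ ∧ b₂ ≤ t₂ ∧
      (∀ x ∈ List.zip L₁ L₂, (f x.1 : ℝ) ≤ t₁ ∧ (f x.2 : ℝ) ≤ t₂ ∨ t₁ ≤ f x.1 ∧ t₂ ≤ f x.2) ∧
      (∀ x ∈ L₁.drop L₂.length, t₁ ≤ f x) ∧ ∀ x ∈ L₂.drop L₁.length, t₂ ≤ f x := by
  induction L₁ generalizing L₂ b₁ b₂ with
  | nil => exact ⟨t - b₂, b₂, by ring, by linarith, le_rfl, by simp, by simp, by simpa using hb₂⟩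
  | cons x L₁ ih =>
    cases L₂ with
    | nil => exact ⟨b₁, t - b₁, by ring, le_rfl, by linarith, by simp, by simpa using hb₁, by simp⟩
    | cons y L₂ =>
      obtain ⟨hx, h₁⟩ := List.pairwise_cons.1 h₁
      obtain ⟨hy, h₂⟩ := List.pairwise_cons.1 h₂
      have hbx := hb₁ x (by simp)
      have hby := hb₂ y (by simp)
      rcases le_total ((f x : ℝ) + f y) t with h | h
      · obtain ⟨t₁, t₂, hs, ht₁, ht₂, hz, hd₁, hd₂⟩ := ih h₁ h₂
          (b₁ := f x) (b₂ := f y) (fun z hz => by exact_mod_cast hx z hz)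
          (fun z hz => by exact_mod_cast hy z hz) h
        refine ⟨t₁, t₂, hs, hbx.trans ht₁, hby.trans ht₂, ?_, by simpa using hd₁, by simpa using hd₂⟩
        rintro z hz'
        rcases List.mem_cons.1 hz' with rfl | hz'
        · exact Or.inl ⟨ht₁, ht₂⟩
        · exact hz z hz'
      · -- The partners at the front already exceed `t`: all elements shall lie above.
        have hx' : ∀ z ∈ x :: L₁, max b₁ (t - f y) ≤ f z := fun z hz => by
          have hxz : (f x : ℝ) ≤ f z := by
            rcases List.mem_cons.1 hz with rfl | hz
            exacts [le_rfl, by exact_mod_cast hx z hz]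
          exact max_le (hbx.trans hxz) (by linarith)
        have hy' : ∀ z ∈ y :: L₂, t - max b₁ (t - f y) ≤ f z := fun z hz => by
          have hyz : (f y : ℝ) ≤ f z := by
            rcases List.mem_cons.1 hz with rfl | hz
            exacts [le_rfl, by exact_mod_cast hy z hz]
          linarith [le_max_right b₁ (t - f y)]
        refine ⟨max b₁ (t - f y), t - max b₁ (t - f y), by ring, le_max_left _ _, ?_, ?_, ?_, ?_⟩
        · rcases max_choice b₁ (t - f y) with h | h <;> rw [h] <;> linarith
        · exact fun z hz => Or.inr ⟨hx' _ (List.of_mem_zip hz).1, hy' _ (List.of_mem_zip hz).2⟩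
        · exact fun z hz => hx' z (List.mem_of_mem_drop hz)
        · exact fun z hz => hy' z (List.mem_of_mem_drop hz)

/-! ### Greedy lists of shortest walks -/

/-- `w` certifies that sending one unit along every member of `L` maximises the total of
`max 0 (t - transit time)` over the units of flow from `u` to `v` in `E`: it is a feasible solution
of the dual linear program which satisfies complementary slackness with `L`. -/
structure IsDual (N : Network V A) (E : Set A) (u v : V) (L : List (List A)) (t : ℝ)
    (w : A → ℝ) : Prop where
  nonneg : ∀ a, 0 ≤ w a
  le : ∀ l, N.WalkIn E u l v → max 0 (t - N.len l) ≤ (l.map w).sum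
  eq : ∀ l ∈ L, (l.map w).sum = max 0 (t - N.len l)
  saturated : ∀ a ∈ E, w a ≠ 0 → arcCount L a = N.cap a

/-- `L` lists walks from `u` to `v` in the order in which a greedy algorithm that always prefers
shortest walks sends single units of flow along them, beginning with the walk `q`, which is
used until one of its arcs is saturated. Optimality is recorded by dual solutions. -/
structure IsGreedy (N : Network V A) (E : Set A) (u v : V) (q : List A) (L : List (List A)) :
    Prop where
  walkIn : ∀ l ∈ L, N.WalkIn E u l v
  sorted : L.Pairwise fun l l' => N.len l ≤ N.len l'
  arcCount_le : ∀ a ∈ E, arcCount L a ≤ N.cap a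
  exists_prefix : ∃ k L', L = List.replicate k q ++ L' ∧ ∃ a ∈ q, N.cap a ≤ k
  exists_dual : ∀ t : ℝ, 0 ≤ t → ∃ w, N.IsDual E u v L t w

theorem IsDual.not_mem_of_le {N : Network V A} {E : Set A} {u v : V} {L : List (List A)} {t : ℝ}
    {w : A → ℝ} (h : N.IsDual E u v L t w) {l : List A} (hl : l ∈ L) (ht : t ≤ N.len l) {a : A}
    (ha : w a ≠ 0) : a ∉ l := fun hal => by
  have h0 := h.eq l hl
  rw [max_eq_left (by linarith)] at h0
  have : w a ≤ (l.map w).sum :=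
    List.single_le_sum (by simpa using fun b _ => h.nonneg b) _ (List.mem_map_of_mem hal)
  exact ha (le_antisymm (by linarith) (h.nonneg a))

open Classical in
/-- Arc weights that are `w₁` on `E₁` and `w₂` elsewhere. -/
def glue (E₁ : Set A) (w₁ w₂ : A → ℝ) (a : A) : ℝ := if a ∈ E₁ then w₁ a else w₂ a

theorem sum_glue_left {E₁ : Set A} {w₁ w₂ : A → ℝ} {l : List A} (hl : ∀ a ∈ l, a ∈ E₁) :
    (l.map (glue E₁ w₁ w₂)).sum = (l.map w₁).sum := by
  congr 1
  exact List.map_congr_left fun a ha => if_pos (hl a ha)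

theorem sum_glue_right {E₁ E₂ : Set A} (hE : Disjoint E₁ E₂) {w₁ w₂ : A → ℝ} {l : List A}
    (hl : ∀ a ∈ l, a ∈ E₂) : (l.map (glue E₁ w₁ w₂)).sum = (l.map w₂).sum := by
  congr 1
  exact List.map_congr_left fun a ha => if_neg (Set.disjoint_right.1 hE (hl a ha))

theorem glue_nonneg {E₁ : Set A} {w₁ w₂ : A → ℝ} (h₁ : ∀ a, 0 ≤ w₁ a) (h₂ : ∀ a, 0 ≤ w₂ a)
    (a : A) : 0 ≤ glue E₁ w₁ w₂ a := by
  unfold glue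
  split_ifs
  exacts [h₁ a, h₂ a]

theorem isGreedy_arc {N : Network V A} {a : A} (h : N.src a ≠ N.dst a) :
    N.IsGreedy {a} (N.src a) (N.dst a) [a] (List.replicate (N.cap a) [a]) where
  walkIn l hl := by
    obtain rfl := List.eq_of_mem_replicate hl
    exact ⟨by simp, rfl, rfl⟩
  sorted := List.pairwise_replicate.2 (Or.inr le_rfl)
  arcCount_le := by
    rintro b rfl
    exact (arcCount_replicate _ (by simp)).le
  exists_prefix := ⟨N.cap a, [], by simp, a, by simp⟩
  exists_dual t _ := by
    refine ⟨fun _ => max 0 (t - N.transit a), fun _ => le_max_left _ _, fun l hl => ?_,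
      fun l hl => ?_, ?_⟩
    · obtain rfl := hl.eq_of_singleton h
      simp [len]
    · obtain rfl := List.eq_of_mem_replicate hl
      simp [len]
    · rintro b rfl -
      exact arcCount_replicate _ (by simp)

/-- In a series composition the greedy flows of the parts are coupled in the order of their
lengths; the surplus of the larger one is dropped. -/
theorem IsGreedy.series {N : Network V A} {E₁ E₂ : Set A} {u m v : V} {q₁ q₂ : List A}
    {L₁ L₂ : List (List A)} (hs₁ : N.SP E₁ u m) (hs₂ : N.SP E₂ m v)
    (h : N.nodes E₁ ∩ N.nodes E₂ = {m}) (h₁ : N.IsGreedy E₁ u m q₁ L₁)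
    (h₂ : N.IsGreedy E₂ m v q₂ L₂) :
    N.IsGreedy (E₁ ∪ E₂) u v (q₁ ++ q₂) (List.zipWith (· ++ ·) L₁ L₂) := by
  have hE := hs₁.disjoint_series h
  have hn₁ : ∀ a ∈ E₁, ∀ l ∈ L₂, a ∉ l := fun a ha l hl hal =>
    Set.disjoint_left.1 hE ha ((h₂.walkIn l hl).1 a hal)
  have hn₂ : ∀ a ∈ E₂, ∀ l ∈ L₁, a ∉ l := fun a ha l hl hal =>
    Set.disjoint_right.1 hE ha ((h₁.walkIn l hl).1 a hal)
  refine ⟨fun l hl => ?_, ?_, ?_, ?_, fun t ht => ?_⟩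
  · obtain ⟨x, hx, rfl⟩ := exists_of_mem_zipWith hl
    have := List.of_mem_zip hx
    exact (h₁.walkIn _ this.1).append (h₂.walkIn _ this.2)
  · refine pairwise_zipWith (fun a a' b b' h h' => ?_) h₁.sorted h₂.sorted
    rw [len_append, len_append]
    exact add_le_add h h'
  · rintro a (ha | ha)
    · rw [arcCount_zipWith_left (hn₁ a ha)]
      exact (arcCount_take_le _ _ _).trans (h₁.arcCount_le a ha)
    · rw [arcCount_zipWith_right (hn₂ a ha)]
      exact (arcCount_take_le _ _ _).trans (h₂.arcCount_le a ha)
  · obtain ⟨k₁, L₁', rfl, a₁, ha₁, hk₁⟩ := h₁.exists_prefix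
    obtain ⟨k₂, L₂', rfl, a₂, ha₂, hk₂⟩ := h₂.exists_prefix
    rcases le_total k₁ k₂ with hk | hk
    · obtain ⟨d, rfl⟩ := Nat.exists_eq_add_of_le hk
      refine ⟨k₁, List.zipWith (· ++ ·) L₁' (List.replicate d q₂ ++ L₂'), ?_, a₁, by simp [ha₁], hk₁⟩
      rw [List.replicate_add, List.append_assoc, List.zipWith_append (by simp),
        List.zipWith_replicate']
    · obtain ⟨d, rfl⟩ := Nat.exists_eq_add_of_le hk
      refine ⟨k₂, List.zipWith (· ++ ·) (List.replicate d q₁ ++ L₁') L₂', ?_, a₂, by simp [ha₂], hk₂⟩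
      rw [List.replicate_add, List.append_assoc, List.zipWith_append (by simp),
        List.zipWith_replicate']
  · obtain ⟨t₁, t₂, rfl, ht₁, ht₂, hz, hd₁, hd₂⟩ := exists_split_threshold h₁.sorted h₂.sorted
      (b₁ := 0) (b₂ := 0) (by simp) (by simp) (by simpa using ht)
    obtain ⟨w₁, hw₁⟩ := h₁.exists_dual t₁ ht₁
    obtain ⟨w₂, hw₂⟩ := h₂.exists_dual t₂ ht₂
    have hsum : ∀ l₁ l₂, N.WalkIn E₁ u l₁ m → N.WalkIn E₂ m l₂ v →
        ((l₁ ++ l₂).map (glue E₁ w₁ w₂)).sum = (l₁.map w₁).sum + (l₂.map w₂).sum :=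
      fun l₁ l₂ h₁ h₂ => by
        rw [List.map_append, List.sum_append, sum_glue_left h₁.1, sum_glue_right hE h₂.1]
    refine ⟨glue E₁ w₁ w₂, glue_nonneg hw₁.nonneg hw₂.nonneg, fun l hl => ?_, fun l hl => ?_, ?_⟩
    · obtain ⟨l₁, l₂, rfl, hl₁, hl₂⟩ := hs₁.split_series hs₂ h hl
      rw [hsum _ _ hl₁ hl₂, len_append]
      have e₁ := max_le_iff.1 (hw₁.le l₁ hl₁)
      have e₂ := max_le_iff.1 (hw₂.le l₂ hl₂)
      push_cast
      exact max_le (by linarith) (by linarith)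
    · obtain ⟨x, hx, rfl⟩ := exists_of_mem_zipWith hl
      have hx' := List.of_mem_zip hx
      rw [hsum _ _ (h₁.walkIn _ hx'.1) (h₂.walkIn _ hx'.2), len_append, hw₁.eq _ hx'.1,
        hw₂.eq _ hx'.2]
      push_cast
      rcases hz x hx with ⟨e₁, e₂⟩ | ⟨e₁, e₂⟩
      · rw [max_eq_right (by linarith), max_eq_right (by linarith), max_eq_right (by linarith)]
        ring
      · rw [max_eq_left (by linarith), max_eq_left (by linarith), max_eq_left (by linarith)]
        ring
    · -- A walk that is dropped is at least as long as the threshold, so it has weight zero.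
      rintro a (ha | ha) hwa
      · rw [glue, if_pos ha] at hwa
        rw [arcCount_zipWith_left (hn₁ a ha), ← hw₁.saturated a ha hwa]
        exact arcCount_take fun l hl =>
          hw₁.not_mem_of_le (List.mem_of_mem_drop hl) (hd₁ l hl) hwa
      · rw [glue, if_neg (Set.disjoint_right.1 hE ha)] at hwa
        rw [arcCount_zipWith_right (hn₂ a ha), ← hw₂.saturated a ha hwa]
        exact arcCount_take fun l hl =>
          hw₂.not_mem_of_le (List.mem_of_mem_drop hl) (hd₂ l hl) hwa

/-- In a parallel composition the greedy flows of the parts are merged in the order of their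
lengths, and a shortest walk may keep its place at the front. -/
theorem IsGreedy.parallel {N : Network V A} {E₁ E₂ : Set A} {u v : V} {q q' : List A}
    {L₁ L₂ : List (List A)} (hs₁ : N.SP E₁ u v) (hs₂ : N.SP E₂ u v) (hE : Disjoint E₁ E₂)
    (h : N.nodes E₁ ∩ N.nodes E₂ = {u, v}) (hq : N.IsShortestIn (E₁ ∪ E₂) u q v)
    (h₁ : N.IsGreedy E₁ u v q L₁) (h₂ : N.IsGreedy E₂ u v q' L₂) :
    ∃ L, N.IsGreedy (E₁ ∪ E₂) u v q L := by
  obtain ⟨k, L', rfl, a, ha, hk⟩ := h₁.exists_prefix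
  set R := (L' ++ L₂).mergeSort fun l l' => decide (N.len l ≤ N.len l') with hR
  have hperm : (List.replicate k q ++ R).Perm ((List.replicate k q ++ L') ++ L₂) := by
    rw [List.append_assoc]
    exact (List.mergeSort_perm _ _).append_left _
  have hcount : ∀ b, arcCount (List.replicate k q ++ R) b =
      arcCount (List.replicate k q ++ L') b + arcCount L₂ b := fun b => by
    rw [hperm.arcCount_eq, arcCount_append]
  have hwalk : ∀ l ∈ List.replicate k q ++ R, N.WalkIn (E₁ ∪ E₂) u l v := fun l hl =>
    (List.mem_append.1 (hperm.mem_iff.1 hl)).elim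
      (fun hl => (h₁.walkIn l hl).mono Set.subset_union_left)
      (fun hl => (h₂.walkIn l hl).mono Set.subset_union_right)
  have hc₁ : ∀ b ∈ E₁, arcCount L₂ b = 0 := fun b hb => arcCount_eq_zero fun l hl hbl =>
    Set.disjoint_left.1 hE hb ((h₂.walkIn l hl).1 b hbl)
  have hc₂ : ∀ b ∈ E₂, arcCount (List.replicate k q ++ L') b = 0 := fun b hb =>
    arcCount_eq_zero fun l hl hbl => Set.disjoint_right.1 hE hb ((h₁.walkIn l hl).1 b hbl)
  refine ⟨List.replicate k q ++ R, hwalk, ?_, ?_, ⟨k, R, rfl, a, ha, hk⟩, fun t ht => ?_⟩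
  · refine List.pairwise_append.2 ⟨List.pairwise_replicate.2 (Or.inr le_rfl), ?_, ?_⟩
    · have := List.pairwise_mergeSort (le := fun l l' => decide (N.len l ≤ N.len l'))
        (by simpa using fun a b c => le_trans) (by simpa using fun a b => le_total _ _) (L' ++ L₂)
      simpa using this
    · intro l hl l' hl'
      obtain rfl := List.eq_of_mem_replicate hl
      exact hq.2 l' (hwalk l' (by simp [hl']))
  · rintro b (hb | hb)
    · rw [hcount, hc₁ b hb]
      exact h₁.arcCount_le b hb
    · rw [hcount, hc₂ b hb, zero_add]
      exact h₂.arcCount_le b hb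
  · obtain ⟨w₁, hw₁⟩ := h₁.exists_dual t ht
    obtain ⟨w₂, hw₂⟩ := h₂.exists_dual t ht
    refine ⟨glue E₁ w₁ w₂, glue_nonneg hw₁.nonneg hw₂.nonneg, fun l hl => ?_, fun l hl => ?_, ?_⟩
    · rcases hs₁.split_parallel hs₂ hE h hl with hl | hl
      · rw [sum_glue_left hl.1]
        exact hw₁.le l hl
      · rw [sum_glue_right hE hl.1]
        exact hw₂.le l hl
    · rcases List.mem_append.1 (hperm.mem_iff.1 hl) with hl | hl
      · rw [sum_glue_left (h₁.walkIn l hl).1]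
        exact hw₁.eq l hl
      · rw [sum_glue_right hE (h₂.walkIn l hl).1]
        exact hw₂.eq l hl
    · rintro b (hb | hb) hwb
      · rw [glue, if_pos hb] at hwb
        rw [hcount, hc₁ b hb]
        exact hw₁.saturated b hb hwb
      · rw [glue, if_neg (Set.disjoint_right.1 hE hb)] at hwb
        rw [hcount, hc₂ b hb, zero_add]
        exact hw₂.saturated b hb hwb

/-- The greedy flow exists in every series-parallel graph and may begin with any shortest walk. -/
theorem SP.exists_isGreedy {N : Network V A} {E : Set A} {u v : V} (h : N.SP E u v) {q : List A}
    (hq : N.IsShortestIn E u q v) : ∃ L, N.IsGreedy E u v q L := by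
  induction h generalizing q with
  | arc a h =>
    obtain rfl := hq.1.eq_of_singleton h
    exact ⟨_, isGreedy_arc h⟩
  | series hs₁ hs₂ h ih₁ ih₂ =>
    obtain ⟨q₁, q₂, rfl, hq₁, hq₂⟩ := hs₁.split_series hs₂ h hq.1
    obtain ⟨L₁, h₁⟩ := ih₁ ⟨hq₁, fun l hl => by
      simpa [len_append] using hq.2 _ (hl.append hq₂)⟩
    obtain ⟨L₂, h₂⟩ := ih₂ ⟨hq₂, fun l hl => by
      simpa [len_append] using hq.2 _ (hq₁.append hl)⟩
    exact ⟨_, h₁.series hs₁ hs₂ h h₂⟩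
  | @parallel E₁ E₂ u v hs₁ hs₂ hE h ih₁ ih₂ =>
    rcases hs₁.split_parallel hs₂ hE h hq.1 with hq' | hq'
    · obtain ⟨q₂, hq₂⟩ := hs₂.exists_isShortestIn
      obtain ⟨L₁, h₁⟩ := ih₁ ⟨hq', fun l hl => hq.2 l (hl.mono Set.subset_union_left)⟩
      obtain ⟨L₂, h₂⟩ := ih₂ hq₂
      exact h₁.parallel hs₁ hs₂ hE h hq h₂
    · obtain ⟨q₁, hq₁⟩ := hs₁.exists_isShortestIn
      obtain ⟨L₁, h₁⟩ := ih₁ hq₁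
      obtain ⟨L₂, h₂⟩ := ih₂ ⟨hq', fun l hl => hq.2 l (hl.mono Set.subset_union_right)⟩
      rw [Set.inter_comm] at h
      rw [Set.union_comm] at hq ⊢
      exact h₂.parallel hs₂ hs₁ hE.symm h hq h₁

/-! ### The value and the peak cost of a temporally repeated flow -/

/-- The point of `[l, r]` nearest to `x`; differences of its values measure parts of `[l, r)`. -/
def clamp (l r x : ℝ) : ℝ := max l (min r x)

theorem integral_indicator_Ico {l r : ℝ} (hlr : l ≤ r) {x y : ℝ} (hxy : x ≤ y) :
    ∫ ξ in x..y, (Set.Ico l r).indicator (fun _ => (1 : ℝ)) ξ = clamp l r y - clamp l r x := by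
  rw [intervalIntegral.integral_of_le hxy, ← integral_Ico_eq_integral_Ioc,
    setIntegral_indicator measurableSet_Ico, Set.Ico_inter_Ico]
  simp only [integral_const, smul_eq_mul, mul_one, measureReal_restrict_apply MeasurableSet.univ,
    Set.univ_inter, Real.volume_real_Ico, clamp]
  simp only [max_def, min_def]
  split_ifs <;> linarith

theorem intervalIntegrable_indicator_Ico (l r x y : ℝ) :
    IntervalIntegrable ((Set.Ico l r).indicator fun _ => (1 : ℝ)) volume x y :=
  ((intervalIntegrable_const (c := (1 : ℝ))).mono_fun
    ((measurable_const.indicator measurableSet_Ico).aestronglyMeasurable)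
    (Filter.Eventually.of_forall fun z => by
      simp only [Set.indicator]; split_ifs <;> simp))

theorem STPath.lengthTo_add_lengthFrom {N : Network V A} (p : N.STPath) (a : A) :
    p.lengthTo a + p.lengthFrom a = p.length := by
  rw [lengthTo, lengthFrom, ← List.sum_append, ← List.map_append, List.takeWhile_append_dropWhile,
    length]

/-- The length of the time interval `[0, T - l)` during which flow departs along a path of
length `l`; it is empty if `T ≤ l`. -/
def window (T l : ℕ) : ℝ := max 0 ((T : ℝ) - l)

open Classical in
theorem trFlow_eq_sum_indicator (N : Network V A) [Fintype A] (T : ℕ) (y : N.STPath → ℝ) (a : A) :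
    N.trFlow T y a = fun θ => ∑ p : N.STPath, (if a ∈ p.arcs then y p else 0) *
      (Set.Ico (p.lengthTo a : ℝ) (p.lengthTo a + window T p.length)).indicator (fun _ => 1) θ := by
  funext θ
  have key : ∀ p : N.STPath, (θ ∈ Set.Ico (p.lengthTo a : ℝ) (p.lengthTo a + window T p.length)) ↔
      ((p.lengthTo a : ℝ) ≤ θ ∧ (p.lengthFrom a : ℝ) < T - θ) := fun p => by
    have h : (p.lengthTo a : ℝ) + p.lengthFrom a = p.length := by
      exact_mod_cast p.lengthTo_add_lengthFrom a
    rw [Set.mem_Ico, window, ← sub_lt_iff_lt_add', lt_max_iff]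
    constructor
    · rintro ⟨h₁, h₂ | h₂⟩
      · linarith
      · exact ⟨h₁, by linarith⟩
    · rintro ⟨h₁, h₂⟩
      exact ⟨h₁, Or.inr (by linarith)⟩
  rw [trFlow]
  split_ifs with hθ
  · refine Finset.sum_congr rfl fun p _ => ?_
    rw [Set.indicator_apply, ite_mul, zero_mul, mul_ite, mul_one, mul_zero, ← ite_and]
    exact if_congr (and_congr_right fun _ => (key p).symm) rfl rfl
  · refine (Finset.sum_eq_zero fun p _ => ?_).symm
    rw [Set.indicator_of_notMem, mul_zero]
    rw [key]
    rintro ⟨h₁, h₂⟩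
    have h₃ : (0 : ℝ) ≤ p.lengthTo a := Nat.cast_nonneg _
    have h₄ : (0 : ℝ) ≤ p.lengthFrom a := Nat.cast_nonneg _
    exact hθ ⟨by linarith, by linarith⟩

open Classical in
theorem integral_trFlow (N : Network V A) [Fintype A] (T : ℕ) (y : N.STPath → ℝ) (a : A)
    {x x' : ℝ} (hx : x ≤ x') :
    ∫ ξ in x..x', N.trFlow T y a ξ = ∑ p : N.STPath, if a ∈ p.arcs then
      y p * (clamp 0 (window T p.length) (x' - p.lengthTo a) -
        clamp 0 (window T p.length) (x - p.lengthTo a)) else 0 := by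
  rw [trFlow_eq_sum_indicator, intervalIntegral.integral_finsetSum fun p _ =>
    (intervalIntegrable_indicator_Ico _ _ _ _).const_mul _]
  refine Finset.sum_congr rfl fun p _ => ?_
  have hw : 0 ≤ window T p.length := le_max_left _ _
  have hc : ∀ z, clamp (p.lengthTo a) (p.lengthTo a + window T p.length) z =
      p.lengthTo a + clamp 0 (window T p.length) (z - p.lengthTo a) := fun z => by
    rw [clamp, clamp, ← max_add_add_left, ← min_add_add_left, add_zero, add_sub_cancel]
  rw [intervalIntegral.integral_const_mul, integral_indicator_Ico (by linarith) hx, hc, hc,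
    add_sub_add_left_eq_sub, ite_mul, zero_mul]

theorem sum_ite_mem_list [Fintype A] [DecidableEq A] {l : List A} (hl : l.Nodup) (g : A → ℝ) :
    (∑ a, if a ∈ l then g a else 0) = (l.map g).sum := by
  rw [← List.sum_toFinset g hl, ← Finset.sum_filter]
  congr 1
  ext a
  simp

open Classical in
/-- Along a path, a sum of increments telescopes. -/
theorem sum_increments {l : List A} (hl : l.Nodup) (τ : A → ℕ) (H : ℝ → ℝ) (θ : ℝ) :
    (l.map fun a => H (θ - ((l.takeWhile fun b => decide (b ≠ a)).map τ).sum) -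
      H (θ - τ a - ((l.takeWhile fun b => decide (b ≠ a)).map τ).sum)).sum =
      H θ - H (θ - (l.map τ).sum) := by
  induction l generalizing θ with
  | nil => simp
  | cons a l ih =>
    obtain ⟨ha, hl⟩ := List.nodup_cons.1 hl
    rw [List.map_cons, List.sum_cons, List.map_congr_left (g := fun b =>
      H (θ - τ a - ((l.takeWhile fun c => decide (c ≠ b)).map τ).sum) -
      H (θ - τ a - τ b - ((l.takeWhile fun c => decide (c ≠ b)).map τ).sum)), ih hl]
    · simp only [ne_eq, not_true_eq_false, decide_false, Bool.false_eq_true, not_false_eq_true,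
        List.takeWhile_cons_of_neg, List.map_nil, List.sum_nil, List.map_cons, List.sum_cons]
      push_cast
      rw [sub_zero, sub_zero, sub_sub θ (τ a : ℝ)]
      ring
    · intro b hb
      have hab : a ≠ b := fun h => ha (h ▸ hb)
      rw [List.takeWhile_cons_of_pos (by simpa using hab), List.map_cons, List.sum_cons]
      push_cast
      congr 2 <;> ring

theorem costAt_trFlow (N : Network V A) [Fintype A] (hunit : ∀ a, N.cost a = 1) (T : ℕ)
    (y : N.STPath → ℝ) (θ : ℝ) :
    N.costAt (N.trFlow T y) θ = ∑ p : N.STPath, y p * (clamp 0 (window T p.length) θ -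
      clamp 0 (window T p.length) (θ - p.length)) := by
  classical
  simp only [costAt, hunit, Nat.cast_one, one_mul]
  rw [Finset.sum_congr rfl fun a _ => N.integral_trFlow T y a (by simp), Finset.sum_comm]
  refine Finset.sum_congr rfl fun p _ => ?_
  have := sum_increments p.arcs_nodup N.transit (clamp 0 (window T p.length)) θ
  rw [← STPath.length] at this
  rw [← this, ← List.sum_map_mul_left, ← sum_ite_mem_list p.arcs_nodup]
  refine Finset.sum_congr rfl fun a _ => ?_
  rw [STPath.lengthTo]

/-- The largest amount of flow that is ever simultaneously on a path of length `l` whose flow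
rate is one. -/
def pathCost (T l : ℕ) : ℝ := min (l : ℝ) (window T l)

theorem clamp_sub_clamp_le (T l : ℕ) (θ : ℝ) :
    clamp 0 (window T l) θ - clamp 0 (window T l) (θ - l) ≤ pathCost T l := by
  have hl : (0 : ℝ) ≤ l := Nat.cast_nonneg l
  have hw : 0 ≤ window T l := le_max_left _ _
  simp only [clamp, pathCost, max_def, min_def]
  split_ifs <;> linarith

theorem clamp_sub_clamp_half (T l : ℕ) :
    clamp 0 (window T l) (T / 2) - clamp 0 (window T l) (T / 2 - l) = pathCost T l := by
  have hl : (0 : ℝ) ≤ l := Nat.cast_nonneg l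
  have hT : (0 : ℝ) ≤ T := Nat.cast_nonneg T
  simp only [clamp, pathCost, window, max_def, min_def]
  split_ifs <;> linarith

/-- With unit arc costs, the flow on each path reaches its peak cost at time `T / 2`, hence the
peak cost of the whole flow is a linear function of the path decomposition. -/
theorem peakCost_trFlow (N : Network V A) [Fintype A] (hunit : ∀ a, N.cost a = 1) {T : ℕ}
    (hT : 0 < T) {y : N.STPath → ℝ} (hy : ∀ p, 0 ≤ y p) :
    N.peakCost T (N.trFlow T y) = ∑ p : N.STPath, y p * pathCost T p.length := by
  have hT' : (0 : ℝ) < T := Nat.cast_pos.2 hT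
  refine IsGreatest.csSup_eq ⟨⟨T / 2, ⟨by linarith, by linarith⟩, ?_⟩, ?_⟩
  · simp only [N.costAt_trFlow hunit, clamp_sub_clamp_half]
  · rintro _ ⟨θ, -, rfl⟩
    rw [N.costAt_trFlow hunit]
    exact Finset.sum_le_sum fun p _ =>
      mul_le_mul_of_nonneg_left (clamp_sub_clamp_le T _ θ) (hy p)

theorem IsWalk.src_mem {N : Network V A} {u v : V} {l : List A} (h : N.IsWalk u l v) {a : A}
    (ha : a ∈ l) : N.src a ∈ u :: l.map N.dst := by
  induction l generalizing u with
  | nil => simp at ha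
  | cons b l ih =>
    obtain ⟨rfl, hw⟩ := h
    rcases List.mem_cons.1 ha with rfl | ha
    · simp
    · exact List.mem_cons_of_mem _ (by simpa using ih hw ha)

open Classical in
/-- A path leaves the source over its first arc only. -/
theorem STPath.sum_out_source {N : Network V A} [Fintype A] (hst : N.source ≠ N.sink)
    (p : N.STPath) (g : ℕ → ℝ) :
    (∑ a, if N.src a = N.source then (if a ∈ p.arcs then g (p.lengthTo a) else 0) else 0) = g 0 := by
  obtain ⟨l, hw, hn⟩ := p
  cases l with
  | nil => exact absurd hw hst
  | cons b l =>
    rw [Finset.sum_eq_single b, if_pos hw.1, if_pos (by simp)]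
    · simp [lengthTo]
    · intro a _ hab
      split_ifs with hs ha
      · have hal : a ∈ l := (List.mem_cons.1 ha).resolve_left hab
        have := hw.2.src_mem hal
        rw [hs] at this
        exact absurd this (List.nodup_cons.1 hn).1
      · rfl
      · rfl
    · simp

/-- The value of a temporally repeated flow is a linear function of its path decomposition. -/
theorem value_trFlow (N : Network V A) [Fintype A] (hst : N.source ≠ N.sink) (T : ℕ)
    (y : N.STPath → ℝ) :
    N.value T (N.trFlow T y) = ∑ p : N.STPath, y p * window T p.length := by
  classical
  have hin : ∀ a, N.dst a = N.source → N.trFlow T y a = 0 := fun a ha => by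
    rw [trFlow_eq_sum_indicator]
    funext θ
    refine Finset.sum_eq_zero fun p _ => ?_
    rw [if_neg, zero_mul]
    intro hap
    exact (List.nodup_cons.1 p.nodup).1 (ha ▸ List.mem_map_of_mem hap)
  have hout : ∀ p : N.STPath, y p * window T p.length =
      ∑ a, if N.src a = N.source then (if a ∈ p.arcs then
        y p * (clamp 0 (window T p.length) (T - p.lengthTo a) -
          clamp 0 (window T p.length) (0 - p.lengthTo a)) else 0) else 0 := fun p => by
    rw [p.sum_out_source hst fun n => y p * (clamp 0 (window T p.length) (T - n) -
          clamp 0 (window T p.length) (0 - n))]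
    have hl : (0 : ℝ) ≤ p.length := Nat.cast_nonneg _
    have hT : (0 : ℝ) ≤ T := Nat.cast_nonneg T
    congr 1
    simp only [clamp, window, max_def, min_def, Nat.cast_zero]
    split_ifs <;> linarith
  have hzero : (∑ a, if N.dst a = N.source then
      ∫ ξ in (0 : ℝ)..(T - N.transit a), N.trFlow T y a ξ else 0) = 0 :=
    Finset.sum_eq_zero fun a _ => by
      split_ifs with ha
      · simp [hin a ha]
      · rfl
  rw [value, hzero, sub_zero, Finset.sum_congr rfl fun p _ => hout p, Finset.sum_comm]
  refine Finset.sum_congr rfl fun a _ => ?_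
  split_ifs
  · exact N.integral_trFlow T y a (Nat.cast_nonneg T)
  · simp

/-! ### Universal optimality of the greedy flow -/

open Classical in
theorem sum_map_sum_eq [Fintype A] {L : List (List A)} (hL : ∀ l ∈ L, l.Nodup) (w : A → ℝ) :
    (L.map fun l => (l.map w).sum).sum = ∑ a, w a * arcCount L a := by
  induction L with
  | nil => simp
  | cons l L ih =>
    rw [List.map_cons, List.sum_cons, ih fun l hl => hL l (by simp [hl]),
      ← sum_ite_mem_list (hL l (by simp)), ← Finset.sum_add_distrib]
    refine Finset.sum_congr rfl fun a _ => ?_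
    rw [arcCount_cons]
    split_ifs <;> push_cast <;> ring

theorem sum_mul_sum_arcs (N : Network V A) [Fintype A] (z : N.STPath → ℝ) (w : A → ℝ) :
    ∑ p : N.STPath, z p * (p.arcs.map w).sum = ∑ a, w a * N.staticFlow z a := by
  classical
  simp only [staticFlow, Finset.mul_sum, ← sum_ite_mem_list (STPath.arcs_nodup _)]
  rw [Finset.sum_comm]
  refine Finset.sum_congr rfl fun a _ => Finset.sum_congr rfl fun p _ => ?_
  split_ifs <;> ring

/-- Weak duality: for every threshold `t`, no feasible flow exceeds the greedy flow in the total of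
`max 0 (t - transit time)` over all units of flow. -/
theorem IsGreedy.sum_le {N : Network V A} [Fintype A] (hSP : N.SP Set.univ N.source N.sink)
    {q : List A} {L : List (List A)} (h : N.IsGreedy Set.univ N.source N.sink q L)
    {z : N.STPath → ℝ} (hz : N.IsFeasible z) {t : ℝ} (ht : 0 ≤ t) :
    ∑ p : N.STPath, z p * max 0 (t - p.length) ≤ (L.map fun l => max 0 (t - N.len l)).sum := by
  obtain ⟨w, hw⟩ := h.exists_dual t ht
  have hL : ∀ l ∈ L, l.Nodup := fun l hl =>
    .of_map _ (List.nodup_cons.1 (hSP.nodup_of_walkIn (h.walkIn l hl))).2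
  calc ∑ p : N.STPath, z p * max 0 (t - p.length)
      ≤ ∑ p : N.STPath, z p * (p.arcs.map w).sum := Finset.sum_le_sum fun p _ =>
        mul_le_mul_of_nonneg_left (hw.le p.arcs ⟨by simp, p.isWalk⟩) (hz.1 p)
    _ = ∑ a, w a * N.staticFlow z a := N.sum_mul_sum_arcs z w
    _ ≤ ∑ a, w a * arcCount L a := Finset.sum_le_sum fun a _ => by
        by_cases ha : w a = 0
        · simp [ha]
        · rw [hw.saturated a (Set.mem_univ a) ha]
          exact mul_le_mul_of_nonneg_left (hz.2 a) (hw.nonneg a)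
    _ = (L.map fun l => (l.map w).sum).sum := (sum_map_sum_eq hL w).symm
    _ = (L.map fun l => max 0 (t - N.len l)).sum := by
        rw [List.map_congr_left hw.eq]

/-! ### Truncating the greedy flow to a given value -/

theorem window_eq_natCast (T l : ℕ) : window T l = ((T - l : ℕ) : ℝ) := by
  rw [window]
  rcases le_total l T with h | h
  · rw [Nat.cast_sub h, max_eq_right (sub_nonneg.2 (Nat.cast_le.2 h))]
  · rw [Nat.sub_eq_zero_of_le h, Nat.cast_zero, max_eq_left (sub_nonpos.2 (Nat.cast_le.2 h))]

/-- A prefix of the list, together with a fraction of the next element, has weight exactly `D`. -/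
theorem exists_truncation {α : Type*} (g : α → ℕ) {M : List α} {D : ℕ} (hD : 0 < D)
    (h : D ≤ (M.map g).sum) : ∃ M₁ p M₂, ∃ c : ℚ, M = M₁ ++ p :: M₂ ∧ 0 < c ∧ c ≤ 1 ∧ 0 < g p ∧
      ((M₁.map g).sum : ℚ) + c * g p = D := by
  induction M generalizing D with
  | nil => simp at h; omega
  | cons x M ih =>
    rw [List.map_cons, List.sum_cons] at h
    rcases le_or_gt D (g x) with hx | hx
    · have hg : (0 : ℚ) < g x := by exact_mod_cast hD.trans_le hx
      refine ⟨[], x, M, D / g x, rfl, by positivity, ?_, hD.trans_le hx, ?_⟩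
      · rw [div_le_one hg]
        exact_mod_cast hx
      · simp [hg.ne']
    · obtain ⟨M₁, p, M₂, c, rfl, hc, hc', hp, hs⟩ := ih (D := D - g x) (by omega) (by omega)
      refine ⟨x :: M₁, p, M₂, c, rfl, hc, hc', hp, ?_⟩
      rw [Nat.cast_sub hx.le] at hs
      rw [List.map_cons, List.sum_cons]
      push_cast at hs ⊢
      linarith

open Classical in
/-- One unit of flow on every member of `M` and `c` units of flow on `p`. -/
def listFlow {N : Network V A} (M : List N.STPath) (p : N.STPath) (c : ℝ) (r : N.STPath) : ℝ :=
  M.count r + if r = p then c else 0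

theorem listFlow_nonneg {N : Network V A} {M : List N.STPath} {p : N.STPath} {c : ℝ}
    (hc : 0 ≤ c) (r : N.STPath) : 0 ≤ listFlow M p c r := by
  unfold listFlow
  split_ifs <;> positivity

theorem listFlow_eq_zero {N : Network V A} {M : List N.STPath} {p : N.STPath} {c : ℝ}
    {r : N.STPath} (hr : r ∉ M) (hrp : r ≠ p) : listFlow M p c r = 0 := by
  classical
  rw [listFlow, if_neg hrp, List.count_eq_zero_of_not_mem hr, Nat.cast_zero, add_zero]

theorem sum_listFlow_mul {N : Network V A} [Finite A] (M : List N.STPath) (p : N.STPath) (c : ℝ)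
    (g : N.STPath → ℝ) : ∑ r, listFlow M p c r * g r = (M.map g).sum + c * g p := by
  classical
  induction M with
  | nil => simp [listFlow]
  | cons x M ih =>
    have : ∀ r, listFlow (x :: M) p c r * g r =
        (if r = x then g r else 0) + listFlow M p c r * g r := fun r => by
      simp only [listFlow, List.count_cons, beq_iff_eq, eq_comm (a := x)]
      split_ifs <;> push_cast <;> ring
    simp only [this, Finset.sum_add_distrib, ih, Finset.sum_ite_eq', Finset.mem_univ, if_true,
      List.map_cons, List.sum_cons]
    ring

open Classical in
theorem staticFlow_eq_sum_mul {N : Network V A} [Fintype A] (y : N.STPath → ℝ) (a : A) :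
    N.staticFlow y a = ∑ p : N.STPath, y p * if a ∈ p.arcs then 1 else 0 := by
  simp [staticFlow]

theorem le_staticFlow {N : Network V A} [Fintype A] {y : N.STPath → ℝ} (hy : ∀ p, 0 ≤ y p)
    {p : N.STPath} {a : A} (ha : a ∈ p.arcs) : y p ≤ N.staticFlow y a := by
  classical
  have := Finset.single_le_sum (f := fun p : N.STPath => if a ∈ p.arcs then y p else 0)
    (fun r _ => by split_ifs; exacts [hy r, le_rfl]) (Finset.mem_univ p)
  simpa [staticFlow, ha] using this

open Classical in
theorem sum_map_mem_eq {N : Network V A} (M : List N.STPath) (a : A) :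
    (M.map fun p : N.STPath => if a ∈ p.arcs then (1 : ℝ) else 0).sum =
      arcCount (M.map STPath.arcs) a := by
  induction M with
  | nil => simp
  | cons p M ih =>
    rw [List.map_cons, List.sum_cons, ih, List.map_cons, arcCount_cons]
    push_cast
    ring

theorem isFeasible_listFlow {N : Network V A} [Fintype A] {M M₁ M₂ : List N.STPath}
    {p : N.STPath} {c : ℝ} (hM : M = M₁ ++ p :: M₂) (hc : 0 ≤ c) (hc' : c ≤ 1)
    (hcap : ∀ a, arcCount (M.map STPath.arcs) a ≤ N.cap a) : N.IsFeasible (listFlow M₁ p c) := by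
  classical
  refine ⟨listFlow_nonneg hc, fun a => le_trans ?_ (Nat.cast_le.2 (hcap a))⟩
  rw [staticFlow_eq_sum_mul, sum_listFlow_mul, ← sum_map_mem_eq, hM, List.map_append,
    List.sum_append, List.map_cons, List.sum_cons, sum_map_mem_eq M₂]
  have : (0 : ℝ) ≤ arcCount (M₂.map STPath.arcs) a := Nat.cast_nonneg _
  split_ifs <;> linarith

/-- Lagrangian multipliers: the cost of a path of length `l` is bounded below by its value, priced
at `ρ`, minus a multiple of `max 0 (t - l)`, and the bound is attained for `l ≤ x`. The price is
the ratio of cost and value of a path of length `x`, which is one as soon as `T ≤ 2 * x`. -/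
theorem exists_multipliers {T x : ℕ} (hx : x < T) : ∃ ρ K t : ℝ, 0 ≤ ρ ∧ 0 ≤ K ∧ 0 ≤ t ∧ t ≤ x ∧
    (∀ l : ℕ, ρ * window T l - K * max 0 (t - l) ≤ pathCost T l) ∧
    ∀ l : ℕ, l ≤ x → pathCost T l = ρ * window T l - K * max 0 (t - l) := by
  have hxT : (x : ℝ) < T := by exact_mod_cast hx
  have hx0 : (0 : ℝ) ≤ x := Nat.cast_nonneg x
  rcases le_or_gt ((x : ℝ) + x) T with h | h
  · have hpos : (0 : ℝ) < T - x := by linarith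
    have heq : ∀ l : ℕ, l ≤ x → pathCost T l =
        x / (T - x) * window T l - T / (T - x) * max 0 ((x : ℝ) - l) := fun l hl => by
      have hl' : (l : ℝ) ≤ x := by exact_mod_cast hl
      rw [pathCost, window, max_eq_right (by linarith), max_eq_right (by linarith),
        min_eq_left (by linarith)]
      field_simp
      ring
    refine ⟨x / (T - x), T / (T - x), x, by positivity, by positivity, hx0, le_rfl,
      fun l => ?_, heq⟩
    rcases le_or_gt l x with hl | hl
    · exact (heq l hl).ge
    · have hl' : (x : ℝ) < l := by exact_mod_cast hl
      have hw : 0 ≤ window T l := le_max_left _ _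
      rw [max_eq_left (by linarith), mul_zero, sub_zero, pathCost]
      refine le_min ?_ (mul_le_of_le_one_left hw ((div_le_one hpos).2 (by linarith)))
      rw [div_mul_eq_mul_div, div_le_iff₀ hpos, window]
      rcases max_cases (0 : ℝ) (T - l) with ⟨e, -⟩ | ⟨e, -⟩ <;> rw [e] <;> nlinarith
  · have heq : ∀ l : ℕ, pathCost T l = 1 * window T l - 2 * max 0 ((T : ℝ) / 2 - l) := fun l => by
      have hl : (0 : ℝ) ≤ l := Nat.cast_nonneg l
      simp only [pathCost, window, max_def, min_def]
      split_ifs <;> linarith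
    exact ⟨1, 2, T / 2, by norm_num, by norm_num, by positivity, by linarith,
      fun l => (heq l).ge, fun l _ => heq l⟩

theorem STPath.bottleneck_le {N : Network V A} (p : N.STPath) {a : A} (ha : a ∈ p.arcs) :
    p.bottleneck ≤ N.cap a :=
  Nat.sInf_le ⟨a, ha, rfl⟩

theorem STPath.exists_cap_eq_bottleneck {N : Network V A} (hst : N.source ≠ N.sink)
    (p : N.STPath) : ∃ a ∈ p.arcs, N.cap a = p.bottleneck := by
  have hne : p.arcs ≠ [] := fun h => hst (by simpa [h, IsWalk] using p.isWalk)
  obtain ⟨a, ha⟩ := List.exists_mem_of_ne_nil _ hne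
  exact Nat.sInf_mem (s := N.cap '' {a | a ∈ p.arcs}) ⟨_, a, ha, rfl⟩

theorem STPath.arcs_injective (N : Network V A) :
    Function.Injective (STPath.arcs : N.STPath → List A) := by
  rintro ⟨l, _, _⟩ ⟨l', _, _⟩ h
  simpa using h

theorem STPath.IsShortest.isShortestIn {N : Network V A} {q : N.STPath} (hq : q.IsShortest)
    (hSP : N.SP Set.univ N.source N.sink) :
    N.IsShortestIn Set.univ N.source q.arcs N.sink :=
  ⟨⟨by simp, q.isWalk⟩, fun l hl => hq ⟨l, hl.2, hSP.nodup_of_walkIn hl⟩⟩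

/-- The greedy flow as a list of source-sink paths. -/
theorem exists_greedy_paths {N : Network V A} [Fintype A] (hSP : N.SP Set.univ N.source N.sink)
    {q : N.STPath} (hq : q.IsShortest) : ∃ (M : List N.STPath) (k : ℕ) (M' : List N.STPath),
      M = List.replicate k q ++ M' ∧ q.bottleneck ≤ k ∧
      M.Pairwise (fun p p' => p.length ≤ p'.length) ∧
      (∀ a, arcCount (M.map STPath.arcs) a ≤ N.cap a) ∧
      ∀ z, N.IsFeasible z → ∀ t : ℝ, 0 ≤ t →
        ∑ p : N.STPath, z p * max 0 (t - p.length) ≤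
          (M.map fun p => max 0 (t - p.length)).sum := by
  obtain ⟨L, hL⟩ := hSP.exists_isGreedy (hq.isShortestIn hSP)
  obtain ⟨M, rfl⟩ : L ∈ Set.range (List.map (STPath.arcs : N.STPath → List A)) := by
    rw [Set.range_list_map]
    exact fun l hl => ⟨⟨l, (hL.walkIn l hl).2, hSP.nodup_of_walkIn (hL.walkIn l hl)⟩, rfl⟩
  obtain ⟨k, L', hL', a, ha, hk⟩ := hL.exists_prefix
  obtain ⟨R, M', rfl, hR, -⟩ := List.map_eq_append_iff.1 hL'
  rw [← List.map_replicate] at hR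
  obtain rfl := List.map_injective_iff.2 (STPath.arcs_injective N) hR
  refine ⟨_, k, M', rfl, (q.bottleneck_le ha).trans hk, (List.pairwise_map (R := fun l l' => N.len l ≤ N.len l')).1 hL.sorted,
    fun a => hL.arcCount_le a (Set.mem_univ a), fun z hz t ht => (hL.sum_le hSP hz ht).trans_eq ?_⟩
  rw [List.map_map]
  rfl

/-- A truncation of the greedy flow has minimum peak cost. -/
theorem peakCost_listFlow_le {N : Network V A} [Fintype A] (hst : N.source ≠ N.sink)
    (hunit : ∀ a, N.cost a = 1) {T D : ℕ} {M M₁ M₂ : List N.STPath} {p : N.STPath} {c : ℝ}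
    (hM : M = M₁ ++ p :: M₂) (hsort : M.Pairwise (fun p p' => p.length ≤ p'.length))
    (hopt : ∀ z, N.IsFeasible z → ∀ t : ℝ, 0 ≤ t →
      ∑ p : N.STPath, z p * max 0 (t - p.length) ≤ (M.map fun p => max 0 (t - p.length)).sum)
    (hc : 0 ≤ c) (hp : p.length < T) (hval : N.value T (N.trFlow T (listFlow M₁ p c)) = D)
    {z : N.STPath → ℝ} (hz : N.IsFeasible z) (hzD : (D : ℝ) ≤ N.value T (N.trFlow T z)) :
    N.peakCost T (N.trFlow T (listFlow M₁ p c)) ≤ N.peakCost T (N.trFlow T z) := by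
  subst hM
  have hT : 0 < T := by omega
  obtain ⟨h₁, h₂, h₁₂⟩ := List.pairwise_append.1 hsort
  obtain ⟨ρ, K, t, hρ, hK, ht, htx, hle, heq⟩ := exists_multipliers hp
  rw [N.peakCost_trFlow hunit hT (listFlow_nonneg hc), N.peakCost_trFlow hunit hT hz.1]
  rw [N.value_trFlow hst] at hval hzD
  -- No path behind the truncation contributes to the total for the threshold `t`.
  have htail : ∀ r ∈ p :: M₂, max 0 (t - r.length) = 0 := fun r hr => by
    have : p.length ≤ r.length := by
      rcases List.mem_cons.1 hr with rfl | hr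
      exacts [le_rfl, (List.pairwise_cons.1 h₂).1 r hr]
    have : (p.length : ℝ) ≤ r.length := by exact_mod_cast this
    exact max_eq_left (by linarith)
  have htot : ((M₁ ++ p :: M₂).map fun r => max 0 (t - r.length)).sum =
      ∑ r, listFlow M₁ p c r * max 0 (t - r.length) := by
    rw [sum_listFlow_mul, List.map_append, List.sum_append, htail p (by simp),
      List.map_congr_left htail]
    simp
  have hsupp : ∀ r, listFlow M₁ p c r * pathCost T r.length =
      ρ * (listFlow M₁ p c r * window T r.length) -
        K * (listFlow M₁ p c r * max 0 (t - r.length)) := fun r => by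
    by_cases hr : r ∈ M₁ ∨ r = p
    · rw [heq r.length]
      · ring
      · rcases hr with hr | rfl
        exacts [h₁₂ r hr p (by simp), le_rfl]
    · rw [not_or] at hr
      simp [listFlow_eq_zero hr.1 hr.2]
  calc ∑ r, listFlow M₁ p c r * pathCost T r.length
      = ρ * D - K * ∑ r, listFlow M₁ p c r * max 0 (t - r.length) := by
        rw [Finset.sum_congr rfl fun r _ => hsupp r, Finset.sum_sub_distrib, ← Finset.mul_sum,
          ← Finset.mul_sum, hval]
    _ ≤ ρ * ∑ r, z r * window T r.length - K * ∑ r, z r * max 0 (t - r.length) :=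
        sub_le_sub (mul_le_mul_of_nonneg_left hzD hρ)
          (mul_le_mul_of_nonneg_left (htot ▸ hopt z hz t ht) hK)
    _ = ∑ r, z r * (ρ * window T r.length - K * max 0 (t - r.length)) := by
        rw [Finset.mul_sum, Finset.mul_sum, ← Finset.sum_sub_distrib]
        exact Finset.sum_congr rfl fun r _ => by ring
    _ ≤ ∑ r, z r * pathCost T r.length := Finset.sum_le_sum fun r _ =>
        mul_le_mul_of_nonneg_left (hle _) (hz.1 r)

end Network

end

open Network in
theorem mainTheorem2 {V A : Type*} [Fintype A]
    (N : Network V A) (hSP : N.IsSeriesParallel) (hunit : ∀ a, N.cost a = 1)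
    (T D : ℕ) (hD : 0 < D)
    (hmax : ∃ z : N.STPath → ℝ, N.IsFeasible z ∧ (D : ℝ) ≤ N.value T (N.trFlow T z))
    (q : N.STPath) (hq : q.IsShortest) :
    q.length < T ∧
    ∃ y : N.STPath → ℝ,
      N.IsMinPeakCost T D y ∧
      N.value T (N.trFlow T y) = D ∧
      N.IsBounded T y ∧
      (∀ p, ∃ r : ℚ, y p = r) ∧
      y q = min (q.bottleneck : ℝ) ((D : ℝ) / ((T : ℝ) - q.length)) ∧
      ∀ a ∈ q.arcs,
        ((q.bottleneck : ℝ) * ((T : ℝ) - q.length) ≤ D →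
          (q.bottleneck : ℝ) ≤ N.staticFlow y a) ∧
        ((D : ℝ) < (q.bottleneck : ℝ) * ((T : ℝ) - q.length) →
          N.staticFlow y a = (D : ℝ) / ((T : ℝ) - q.length)) := by
  classical
  have hst : N.source ≠ N.sink := hSP.1.terminals.1
  obtain ⟨M, k, M', hMk, hk, hsort, hcap, hopt⟩ := exists_greedy_paths hSP.1 hq
  have hDM : D ≤ (M.map fun p => T - p.length).sum := by
    obtain ⟨z, hz, hzD⟩ := hmax
    rw [N.value_trFlow hst] at hzD
    have : (D : ℝ) ≤ (M.map fun p => window T p.length).sum :=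
      hzD.trans (hopt z hz T (Nat.cast_nonneg T))
    rw [List.map_congr_left (g := fun p : N.STPath => ((T - p.length : ℕ) : ℝ))
      fun p _ => window_eq_natCast T p.length] at this
    have e : ((M.map fun p => T - p.length).sum : ℝ) =
        (M.map fun p => ((T - p.length : ℕ) : ℝ)).sum := by
      rw [Nat.cast_list_sum, List.map_map]
      rfl
    exact_mod_cast e ▸ this
  obtain ⟨M₁, p, M₂, c, hM, hc, hc', hp, hs⟩ := exists_truncation _ hD hDM
  have hpT : p.length < T := by omega
  have hqT : q.length < T := (hq p).trans_lt hpT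
  have hqT' : (0 : ℝ) < T - q.length := sub_pos.2 (by exact_mod_cast hqT)
  have hcR : (0 : ℝ) ≤ c := by exact_mod_cast hc.le
  have hcR' : (c : ℝ) ≤ 1 := by exact_mod_cast hc'
  set y : N.STPath → ℝ := listFlow M₁ p c with hy
  have hy0 : ∀ r, 0 ≤ y r := listFlow_nonneg hcR
  have hfeas : N.IsFeasible y := isFeasible_listFlow hM hcR hcR' hcap
  have hsum : ∑ r, y r * window T r.length = D := by
    simp only [hy, sum_listFlow_mul, window_eq_natCast]
    have := congrArg (Rat.cast : ℚ → ℝ) hs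
    push_cast [Nat.cast_list_sum, List.map_map] at this
    exact this
  have hval : N.value T (N.trFlow T y) = D := by rw [N.value_trFlow hst, hsum]
  have hwq : window T q.length = T - q.length := max_eq_right hqT'.le
  have hyq : y q ≤ q.bottleneck := by
    obtain ⟨a, ha, hab⟩ := q.exists_cap_eq_bottleneck hst
    rw [← hab]
    exact (le_staticFlow hy0 ha).trans (hfeas.2 a)
  refine ⟨hqT, y, ⟨hfeas, hval.ge, fun z hz hzD =>
    peakCost_listFlow_le hst hunit hM hsort hopt hcR hpT hval hz hzD⟩, hval, fun r hr => ?_,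
    fun r => ⟨M₁.count r + if r = p then c else 0, ?_⟩, ?_⟩
  · by_contra hrT
    refine hr.ne' (listFlow_eq_zero (fun hrM => hrT ?_) fun h => hrT (h ▸ hpT.le))
    rw [hM] at hsort
    exact ((List.pairwise_append.1 hsort).2.2 r hrM p (by simp)).trans hpT.le
  · simp only [hy, listFlow]
    split_ifs <;> push_cast <;> rfl
  have hcases : (k : ℝ) ≤ y q ∨ (p = q ∧ ∀ r ∈ M₁, r = q) := by
    have hfull : ∀ R, M₁ = List.replicate k q ++ R → (k : ℝ) ≤ y q := fun R hR => by
      have : k ≤ M₁.count q := by simp [hR]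
      have : (k : ℝ) ≤ M₁.count q := by exact_mod_cast this
      simp only [hy, listFlow]
      split_ifs <;> linarith
    rcases List.append_eq_append_iff.1 (hM.symm.trans hMk) with ⟨R, hR, hR'⟩ | ⟨R, hR, -⟩
    · cases R with
      | nil => exact Or.inl (hfull [] (by simpa using hR.symm))
      | cons x R =>
        obtain rfl : p = x := (List.cons.inj hR').1
        have hmem : ∀ r ∈ M₁ ++ p :: R, r = q := fun r hr =>
          List.eq_of_mem_replicate (hR ▸ hr)
        exact Or.inr ⟨hmem p (by simp), fun r hr => hmem r (by simp [hr])⟩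
    · exact Or.inl (hfull R hR)
  rcases hcases with hkq | ⟨hpq, hMq⟩
  · -- The truncation lies behind the initial copies of `q`.
    have hkR : (q.bottleneck : ℝ) ≤ k := by exact_mod_cast hk
    have hyq' : y q = q.bottleneck := le_antisymm hyq (hkR.trans hkq)
    have hbD : (q.bottleneck : ℝ) * (T - q.length) ≤ D := by
      rw [← hsum, ← hyq', ← hwq]
      exact Finset.single_le_sum (f := fun r => y r * window T r.length)
        (fun r _ => mul_nonneg (hy0 r) (le_max_left _ _)) (Finset.mem_univ q)
    refine ⟨?_, fun a ha => ⟨fun _ => hyq' ▸ le_staticFlow hy0 ha, fun h => absurd hbD h.not_ge⟩⟩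
    rw [hyq', min_eq_left ((le_div_iff₀ hqT').2 hbD)]
  · -- The truncation lies among the initial copies of `q`: the flow uses no other path.
    have hzero : ∀ r, r ≠ q → y r = 0 := fun r hr =>
      listFlow_eq_zero (fun h => hr (hMq r h)) (hpq ▸ hr)
    have hyD : y q * (T - q.length) = D := by
      rw [← hsum, ← hwq, Finset.sum_eq_single q (fun r _ hr => by rw [hzero r hr, zero_mul])
        (by simp)]
    have hyq' : y q = D / (T - q.length) := (eq_div_iff hqT'.ne').2 hyD
    have hflow : ∀ a ∈ q.arcs, N.staticFlow y a = y q := fun a ha => by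
      rw [staticFlow_eq_sum_mul, Finset.sum_eq_single q
        (fun r _ hr => by rw [hzero r hr, zero_mul]) (by simp), if_pos ha, mul_one]
    refine ⟨?_, fun a ha => ⟨fun h => ?_, fun _ => ?_⟩⟩
    · rw [← hyq', min_eq_right hyq]
    · rw [hflow a ha, hyq']
      exact (le_div_iff₀ hqT').2 h
    · rw [hflow a ha, hyq']
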